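/- Let $\mathbb X$ be a Banach space over $\mathbb F\in\{\mathbb R,\mathbb C\}$ and let $\mathcal X=(x_n)_{n\in\mathbb N}\subset\mathbb X$ be a basis: the linear span of $\{x_n\}$ is dense in $\mathbb X$, there are $x_n^*\in\mathbb X^*$ with $x_n^*(x_m)=\delta_{n,m}$, and $\sup_n\|x_n\|<\infty$, $\sup_n\|x_n^*\|<\infty$. Write $\operatorname{supp}(x)=\{n: x_n^*(x)\ne 0\}$ and, for finite $A\subset\mathbb N$, $P_A(x)=\sum_{n\in A}x_n^*(x)x_n$. A set $A\subset\mathbb N$ with $|A|=m$ is a greedy set for $x$ of cardinality $m$ if $|x_n^*(x)|\ge|x_k^*(x)|$ for all $n\in A$, $k\notin A$. A sequence $\mathcal O=(k_j)_{j\ge1}$ in $\mathbb N$ is a greedy ordering for $x$ if $\{k_1,\dots,k_m\}$ is a greedy set for $x$ of cardinality $m$ for every $m\in\mathbb N$; then let $C_n^{\mathcal O}(x)=\sum_{j=1}^n\frac{n+1-j}{n}\,x_{k_j}^*(x)\,x_{k_j}$. For a constant $C>0$, the basis is - $C$-quasi-greedy if $\|P_A(x)\|\le C\|x\|$ for all $x\in\mathbb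 X$ and all finite greedy sets $A$ for $x$; - $C$-de la Vallée-Poussin quasi-greedy ($C$-VPQG) if $\|2C_{2n}^{\mathcal O}(x)-C_n^{\mathcal O}(x)\|\le C\|x\|$ for all $x\in\mathbb X$, $n\in\mathbb N$ and all greedy orderings $\mathcal O$ for $x$; - $C$-democratic if $\|\sum_{n\in A}x_n\|\le C\|\sum_{n\in B}x_n\|$ for all finite $A,B\subset\mathbb N$ with $|A|=|B|$; - $C$-superdemocratic if $\|\sum_{n\in A}\varepsilon_nx_n\|\le C\|\sum_{n\in B}\varepsilon'_nx_n\|$ for all finite $A,B\subset\mathbb N$ with $|A|=|B|$ and all scalars $\varepsilon_n,\varepsilon'_n$ of modulus $1$; and it has one of these properties (without a constant) if it has it for some $C>0$. For $t\ge0$ and $0<s\le1$ let $\Psi(t,s)\in[1,\infty]$ be the least $C\in[1,\infty]$ such that $\big\|\sum_{j\in\operatorname{supp}(y)}a_jx_j^*(y)x_j\big\|\le C\|x+y+z\|$ whenever: $x,y,z\in\mathbb X$ have pairwise disjoint supports; $|x_k^*(x)|\ge|x_n^*(y)|$ for all $k\in\operatorname{supp}(x)$, $n\in\mathbb N$, and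 $|x_k^*(y)|\ge|x_n^*(z)|$ for all $k\in\operatorname{supp}(y)$, $n\in\mathbb N$; $\operatorname{supp}(y)$ is finite and $|\operatorname{supp}(x)|\le t\,|\operatorname{supp}(y)|$; $\max_{n\in\operatorname{supp}(y)}|x_n^*(y)|\le s^{-1}\min_{n\in\operatorname{supp}(y)}|x_n^*(y)|$ (no condition if $y$ has empty support); and $(a_j)_{j\in\operatorname{supp}(y)}$ are scalars with $|a_j|\le1$. **Proposition.** Let $\mathcal X$ be a de la Vallée-Poussin quasi-greedy basis of $\mathbb X$. If $\mathcal X$ is democratic, then it is quasi-greedy. More precisely, in that case $\mathcal X$ is superdemocratic, $\Psi(1,\tfrac14)<\infty$, and whenever $\mathcal X$ is $K_1$-VPQG and $K_2$-superdemocratic, it is $C$-quasi-greedy with $$C=K_1+(2+4K_2)\,\Psi\big(1,\tfrac14\big).$$ -/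

import Mathlib

open scoped ENNReal

/-- A (seminormalized) basis of a normed space `X` over `𝕜`: a sequence with dense linear span that
has a biorthogonal sequence of continuous functionals, both sequences being bounded in norm.
The index set `{1, 2, 3, …}` is replaced by `ℕ = {0, 1, 2, …}`. -/
structure GreedyBasis (𝕜 : Type*) (X : Type*) [RCLike 𝕜] [NormedAddCommGroup X]
    [NormedSpace 𝕜 X] where
  /-- the basis vectors -/
  vec : ℕ → X
  /-- the dual basis -/
  coord : ℕ → (X →L[𝕜] 𝕜)
  dense_span : (Submodule.span 𝕜 (Set.range vec)).topologicalClosure = ⊤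
  biorthogonal : ∀ i j, coord i (vec j) = if i = j then 1 else 0
  bounded_vec : ∃ M : ℝ, ∀ n, ‖vec n‖ ≤ M
  bounded_coord : ∃ M : ℝ, ∀ n, ‖coord n‖ ≤ M

namespace GreedyBasis

variable {𝕜 : Type*} {X : Type*} [RCLike 𝕜] [NormedAddCommGroup X] [NormedSpace 𝕜 X]

/-- The support of a vector. -/
def supp (b : GreedyBasis 𝕜 X) (x : X) : Set ℕ := {n | b.coord n x ≠ 0}

/-- The coordinate projection `P_A`. -/
def proj (b : GreedyBasis 𝕜 X) (A : Finset ℕ) (x : X) : X :=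
  ∑ n ∈ A, b.coord n x • b.vec n

/-- `A` is a greedy set for `x` of cardinality `m`. -/
def IsGreedySet (b : GreedyBasis 𝕜 X) (x : X) (m : ℕ) (A : Finset ℕ) : Prop :=
  A.card = m ∧ ∀ n ∈ A, ∀ k ∉ A, ‖b.coord k x‖ ≤ ‖b.coord n x‖

/-- `k 0, k 1, k 2, …` is a greedy ordering for `x`: its first `m` terms form a greedy set for `x`
of cardinality `m`, for every `m` (in particular, `k` is injective). -/
def IsGreedyOrdering (b : GreedyBasis 𝕜 X) (x : X) (k : ℕ → ℕ) : Prop :=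
  ∀ m : ℕ, b.IsGreedySet x m ((Finset.range m).image k)

/-- The `n`-greedy Cesàro sum of `x` for the ordering `k`. The term with (0-based) index `j` is the
`(j + 1)`-st one of the ordering, so that its weight is `(n + 1 - (j + 1)) / n`. -/
def cesaroSum (b : GreedyBasis 𝕜 X) (k : ℕ → ℕ) (n : ℕ) (x : X) : X :=
  ∑ j ∈ Finset.range n, (((n : 𝕜) - (j : 𝕜)) / (n : 𝕜) * b.coord (k j) x) • b.vec (k j)

/-- `C`-quasi-greedy. -/
def IsQuasiGreedy (b : GreedyBasis 𝕜 X) (C : ℝ) : Prop :=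
  0 < C ∧ ∀ (x : X) (m : ℕ) (A : Finset ℕ), b.IsGreedySet x m A → ‖b.proj A x‖ ≤ C * ‖x‖

/-- `C`-de la Vallée-Poussin quasi-greedy. -/
def IsVPQG (b : GreedyBasis 𝕜 X) (C : ℝ) : Prop :=
  0 < C ∧ ∀ (x : X) (n : ℕ) (k : ℕ → ℕ), 1 ≤ n → b.IsGreedyOrdering x k →
    ‖(2 : 𝕜) • b.cesaroSum k (2 * n) x - b.cesaroSum k n x‖ ≤ C * ‖x‖

/-- The indicator sum of `A` with signs `ε`. -/
def indicatorSum (b : GreedyBasis 𝕜 X) (ε : ℕ → 𝕜) (A : Finset ℕ) : X :=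
  ∑ n ∈ A, ε n • b.vec n

/-- `C`-democratic. -/
def IsDemocratic (b : GreedyBasis 𝕜 X) (C : ℝ) : Prop :=
  0 < C ∧ ∀ A B : Finset ℕ, A.card = B.card →
    ‖b.indicatorSum (fun _ => 1) A‖ ≤ C * ‖b.indicatorSum (fun _ => 1) B‖

/-- `C`-superdemocratic. -/
def IsSuperdemocratic (b : GreedyBasis 𝕜 X) (C : ℝ) : Prop :=
  0 < C ∧ ∀ (A B : Finset ℕ) (ε ε' : ℕ → 𝕜), A.card = B.card →
    (∀ n ∈ A, ‖ε n‖ = 1) → (∀ n ∈ B, ‖ε' n‖ = 1) →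
    ‖b.indicatorSum ε A‖ ≤ C * ‖b.indicatorSum ε' B‖

/-- The oscillation of `x` on a finite set `A` contained in the support of `x`; it is `1` if `A` is
empty. -/
noncomputable def osc (b : GreedyBasis 𝕜 X) (x : X) (A : Finset ℕ) : ℝ :=
  if h : A.Nonempty then
    A.sup' h (fun n => ‖b.coord n x‖) / A.inf' h (fun n => ‖b.coord n x‖)
  else 1

/-- `x ▷ y`: every nonzero coordinate of `x` is in modulus at least every coordinate of `y`. -/
def Dominates (b : GreedyBasis 𝕜 X) (x y : X) : Prop :=
  ∀ k ∈ b.supp x, ∀ n : ℕ, ‖b.coord n y‖ ≤ ‖b.coord k x‖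

/-- The inequality defining `Ψ(t, s)` holds with the constant `C`. Here `B` is the (finite) support
of `y`. -/
def PsiBound (b : GreedyBasis 𝕜 X) (t s : ℝ) (C : ℝ≥0∞) : Prop :=
  ∀ (x y z : X) (B : Finset ℕ) (a : ℕ → 𝕜),
    Disjoint (b.supp x) (b.supp y) → Disjoint (b.supp x) (b.supp z) →
    Disjoint (b.supp y) (b.supp z) →
    b.Dominates x y → b.Dominates y z →
    (B : Set ℕ) = b.supp y →
    (b.supp x).Finite → ((b.supp x).ncard : ℝ) ≤ t * (B.card : ℝ) →
    b.osc y B ≤ s⁻¹ →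
    (∀ j ∈ B, ‖a j‖ ≤ 1) →
    ENNReal.ofReal ‖∑ j ∈ B, (a j * b.coord j y) • b.vec j‖ ≤ C * ENNReal.ofReal ‖x + y + z‖

/-- The function `Ψ`, with values in `[1, ∞]`: the least constant `C ≥ 1` in `PsiBound`. -/
noncomputable def Psi (b : GreedyBasis 𝕜 X) (t s : ℝ) : ℝ≥0∞ :=
  sInf {C : ℝ≥0∞ | 1 ≤ C ∧ b.PsiBound t s C}

end GreedyBasis

/-!
For a greedy ordering `k` of `f` put `aⱼ = |f_{k j}|`, where `fₙ` is the `n`-th coordinate.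

*Superdemocracy.* A de la Vallée-Poussin sum is `(S₂ₚ - Sₚ) / p` with `Sₙ = n Cₙ` (`rampSum`), so
passing from `p` to `2p` and `2p + 1` shows that all greedy Cesàro sums are uniformly bounded
(`exists_norm_rampSum_le`). Coordinates of largest modulus may be enumerated in any order, and the
Cesàro weights of an enumeration and of its reversal add up to a constant; hence restricting `f` to
a set of coordinates of largest modulus is bounded (`norm_proj_le_of_level`). Applied to
indicator sums this is unconditionality for constant coefficients, which turns democracy into
superdemocracy (`exists_isSuperdemocratic`).

*Finiteness of `Ψ(1, 1/4)`.* Second differences of `n ↦ Sₙ` give trapezoidal weights supported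
exactly on a prescribed block of positions, with a norm bound if the block is not short compared
with its distance from the beginning. The positions of the support of `y` in a greedy ordering of
`x + y + z` contain such a block on which the coordinates are within a factor `1 + η` of each other
(`exists_block_of_antitone`). There the weighted vector is a small perturbation of one with exactly
known coefficients, to which the restriction bound applies (`norm_indicatorSum_block_le`).
Superdemocracy then compares all of `y` with the block (`Psi_ne_top`).

*Quasi-greediness.* The `m`-th de la Vallée-Poussin sum differs from the `m`-th partial sum by at
most `m` terms with coefficients at most `aₘ`. Sums of at most `m` terms with coefficients at most
`aₘ₋₁` are bounded by `2 K₂ Ψ ‖f‖` (`IsSuperdemocratic.norm_sum_le_Psi`), by induction: either `a`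
varies by at most a factor `4` on the positions from `m / 2` to `m`, and `Ψ` applies to that block,
or `a` drops by a factor `4`, which outweighs the passage from `m` to `m / 2` terms.
-/

namespace GreedyBasis

variable {𝕜 : Type*} {X : Type*} [RCLike 𝕜] [NormedAddCommGroup X] [NormedSpace 𝕜 X]

/-! ### Sums with coefficients in a box -/

/-- A norm bound for all sums `∑ εᵢ vᵢ` with `εᵢ` an endpoint of a segment is inherited by the sums
with `εᵢ` in the segment. The vector `v₀` makes the induction on `s` work. -/
theorem norm_add_sum_smul_le_of_segment {ι : Type*} [DecidableEq ι] (s : Finset ι) (v : ι → X)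
    (c p q : ι → 𝕜) (R : ℝ) (hc : ∀ i ∈ s, c i ∈ segment ℝ (p i) (q i)) (v₀ : X)
    (h : ∀ ε : ι → 𝕜, (∀ i ∈ s, ε i = p i ∨ ε i = q i) → ‖v₀ + ∑ i ∈ s, ε i • v i‖ ≤ R) :
    ‖v₀ + ∑ i ∈ s, c i • v i‖ ≤ R := by
  induction s using Finset.induction_on generalizing v₀ with
  | empty => simpa using h p (by simp)
  | insert i s hi ih =>
    have key : ∀ r : 𝕜, (r = p i ∨ r = q i) → ‖(v₀ + r • v i) + ∑ j ∈ s, c j • v j‖ ≤ R := by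
      intro r hr
      refine ih (fun j hj => hc j (Finset.mem_insert_of_mem hj)) _ fun ε hε => ?_
      have h1 := h (Function.update ε i r) (by
        intro j hj
        rcases Finset.mem_insert.1 hj with rfl | hj
        · simpa using hr
        · have : j ≠ i := fun e => hi (e ▸ hj)
          simpa [this] using hε j hj)
      rw [Finset.sum_insert hi] at h1
      have h2 : ∑ j ∈ s, Function.update ε i r j • v j = ∑ j ∈ s, ε j • v j :=
        Finset.sum_congr rfl fun j hj => by
          have : j ≠ i := fun e => hi (e ▸ hj)
          simp [this]
      rw [h2] at h1
      simpa [add_assoc] using h1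
    obtain ⟨a, d, ha, hd, had, hci⟩ := hc i (Finset.mem_insert_self i s)
    rw [Finset.sum_insert hi]
    have had' : (a : 𝕜) + (d : 𝕜) = 1 := by exact_mod_cast had
    have hci' : c i = (a : 𝕜) * p i + (d : 𝕜) * q i := by
      rw [← hci, RCLike.real_smul_eq_coe_mul, RCLike.real_smul_eq_coe_mul]
    have e : v₀ + (c i • v i + ∑ j ∈ s, c j • v j)
        = (a : 𝕜) • ((v₀ + p i • v i) + ∑ j ∈ s, c j • v j)
          + (d : 𝕜) • ((v₀ + q i • v i) + ∑ j ∈ s, c j • v j) := by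
      have : ∀ w : X, w = (a : 𝕜) • w + (d : 𝕜) • w := fun w => by
        rw [← add_smul, had', one_smul]
      rw [hci']
      calc _ = (v₀ + ∑ j ∈ s, c j • v j) + ((a : 𝕜) * p i + (d : 𝕜) * q i) • v i := by abel
        _ = ((a : 𝕜) • (v₀ + ∑ j ∈ s, c j • v j) + (d : 𝕜) • (v₀ + ∑ j ∈ s, c j • v j))
            + ((a : 𝕜) * p i + (d : 𝕜) * q i) • v i := by rw [← this]
        _ = _ := by module
    rw [e]
    refine (norm_add_le _ _).trans ?_
    rw [norm_smul, norm_smul, RCLike.norm_ofReal, RCLike.norm_ofReal, abs_of_nonneg ha,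
      abs_of_nonneg hd]
    have h1 := mul_le_mul_of_nonneg_left (key _ (Or.inl rfl)) ha
    have h2 := mul_le_mul_of_nonneg_left (key _ (Or.inr rfl)) hd
    calc _ ≤ a * R + d * R := add_le_add h1 h2
      _ = R := by rw [← add_mul, had, one_mul]

/-- A scalar of modulus at most `1` lies on the diameter of the unit disc through it. -/
theorem exists_mem_segment_neg (c : 𝕜) (hc : ‖c‖ ≤ 1) :
    ∃ u : 𝕜, ‖u‖ = 1 ∧ c ∈ segment ℝ u (-u) := by
  obtain ⟨u, hu, hcu⟩ : ∃ u : 𝕜, ‖u‖ = 1 ∧ c = (‖c‖ : 𝕜) * u := by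
    by_cases h : c = 0
    · exact ⟨1, by simp, by simp [h]⟩
    · have h' : (‖c‖ : 𝕜) ≠ 0 := by simpa using h
      refine ⟨c / (‖c‖ : 𝕜), ?_, by field_simp⟩
      rw [norm_div, RCLike.norm_ofReal, abs_norm, div_self (norm_ne_zero_iff.2 h)]
  refine ⟨u, hu, (1 + ‖c‖) / 2, (1 - ‖c‖) / 2, by positivity, by linarith, by ring, ?_⟩
  rw [RCLike.real_smul_eq_coe_mul, RCLike.real_smul_eq_coe_mul]
  conv_rhs => rw [hcu]
  push_cast
  ring

theorem norm_sum_smul_le_of_unimodular {ι : Type*} [DecidableEq ι] (s : Finset ι) (v : ι → X)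
    (c : ι → 𝕜) (R : ℝ) (hc : ∀ i ∈ s, ‖c i‖ ≤ 1)
    (h : ∀ ε : ι → 𝕜, (∀ i ∈ s, ‖ε i‖ = 1) → ‖∑ i ∈ s, ε i • v i‖ ≤ R) :
    ‖∑ i ∈ s, c i • v i‖ ≤ R := by
  have : ∀ i, ∃ u : 𝕜, i ∈ s → ‖u‖ = 1 ∧ c i ∈ segment ℝ u (-u) := fun i => by
    by_cases hi : i ∈ s
    · obtain ⟨u, hu⟩ := exists_mem_segment_neg (c i) (hc i hi)
      exact ⟨u, fun _ => hu⟩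
    · exact ⟨1, fun h => absurd h hi⟩
  choose u hu using this
  have := norm_add_sum_smul_le_of_segment s v c u (fun i => -u i) R (fun i hi => (hu i hi).2) 0 ?_
  · simpa using this
  · intro ε hε
    rw [zero_add]
    refine h ε fun i hi => ?_
    rcases hε i hi with e | e <;> simp [e, (hu i hi).1]

/-- A bound for the sums over sets of at most `p` elements gives a bound for the sums over sets of
at most `m * p` elements, by cutting the latter into `m` pieces. -/
theorem norm_sum_le_of_card_le_mul {ι : Type*} [DecidableEq ι] (v : ι → X) (p m : ℕ) (R : ℝ)
    (E : Finset ι) (hR : ∀ E' ⊆ E, E'.card ≤ p → ‖∑ i ∈ E', v i‖ ≤ R) (hE : E.card ≤ m * p) :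
    ‖∑ i ∈ E, v i‖ ≤ m * R := by
  induction m generalizing E with
  | zero =>
    have : E = ∅ := Finset.card_eq_zero.1 (by omega)
    simp [this]
  | succ m ih =>
    obtain ⟨F, hFE, hF⟩ := Finset.exists_subset_card_eq (min_le_left E.card p)
    have h1 := hR F hFE (by omega)
    have h2 := ih (E \ F) (fun E' hE' => hR E' (hE'.trans Finset.sdiff_subset)) (by
      rw [Finset.card_sdiff_of_subset hFE, hF]
      have : (m + 1) * p = m * p + p := by ring
      omega)
    rw [← Finset.sum_sdiff hFE]
    refine (norm_add_le _ _).trans ?_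
    push_cast
    linarith

/-! ### Coordinates -/

variable (b : GreedyBasis 𝕜 X)

theorem coord_sum_smul_vec {ι : Type*} [DecidableEq ι] {k : ι → ℕ} (hk : Function.Injective k)
    (J : Finset ι) (g : ι → 𝕜) (i : ι) :
    b.coord (k i) (∑ j ∈ J, g j • b.vec (k j)) = if i ∈ J then g i else 0 := by
  simp [map_sum, b.biorthogonal, hk.eq_iff]

theorem coord_sum_smul_vec_of_notMem {ι : Type*} {k : ι → ℕ} (J : Finset ι) (g : ι → 𝕜) {n : ℕ}
    (hn : ∀ j ∈ J, k j ≠ n) : b.coord n (∑ j ∈ J, g j • b.vec (k j)) = 0 := by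
  rw [map_sum]
  refine Finset.sum_eq_zero fun j hj => ?_
  simp [b.biorthogonal, (hn j hj).symm]

theorem coord_proj (A : Finset ℕ) (f : X) (n : ℕ) :
    b.coord n (b.proj A f) = if n ∈ A then b.coord n f else 0 := by
  simp [proj, map_sum, b.biorthogonal]

/-- The coordinates of a vector are a null sequence. -/
theorem finite_setOf_le_norm_coord (f : X) {δ : ℝ} (hδ : 0 < δ) :
    {n | δ ≤ ‖b.coord n f‖}.Finite := by
  obtain ⟨M, hM⟩ := b.bounded_coord
  have hM0 : 0 ≤ M := (norm_nonneg _).trans (hM 0)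
  have hf : f ∈ closure (Submodule.span 𝕜 (Set.range b.vec) : Set X) := by
    rw [← Submodule.topologicalClosure_coe, b.dense_span]; trivial
  obtain ⟨g, hg, hfg⟩ := Metric.mem_closure_iff.1 hf (δ / (M + 1)) (by positivity)
  obtain ⟨c, rfl⟩ := (Finsupp.mem_span_range_iff_exists_finsupp).1 hg
  refine c.support.finite_toSet.subset fun n hn => ?_
  by_contra hnc
  have h0 : b.coord n (c.sum fun i a => a • b.vec i) = 0 :=
    b.coord_sum_smul_vec_of_notMem (k := id) c.support c (fun j hj e => hnc (by
      rw [← show j = n from e]; exact hj))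
  have h1 : ‖b.coord n f‖ ≤ M * ‖f - c.sum fun i a => a • b.vec i‖ := by
    have := (b.coord n).le_of_opNorm_le (hM n) (f - c.sum fun i a => a • b.vec i)
    rwa [map_sub, h0, sub_zero] at this
  rw [dist_eq_norm] at hfg
  have h2 : M * ‖f - c.sum fun i a => a • b.vec i‖ ≤ M * (δ / (M + 1)) := by gcongr
  have h3 : M * (δ / (M + 1)) < δ := by
    rw [mul_div_assoc', div_lt_iff₀ (by positivity)]; nlinarith
  have : δ ≤ ‖b.coord n f‖ := hn
  linarith

theorem exists_norm_coord_max (f : X) (F : Finset ℕ) :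
    ∃ n, n ∉ F ∧ ∀ j, j ∉ F → ‖b.coord j f‖ ≤ ‖b.coord n f‖ := by
  by_cases h : ∃ j, j ∉ F ∧ b.coord j f ≠ 0
  · obtain ⟨j₀, hj₀, hj₀'⟩ := h
    have hfin := (b.finite_setOf_le_norm_coord f (norm_pos_iff.2 hj₀')).subset
      (Set.inter_subset_left (t := {j | j ∉ F}))
    obtain ⟨n, hn, hmax⟩ := Set.exists_max_image _ (fun j => ‖b.coord j f‖) hfin
      ⟨j₀, le_refl ‖b.coord j₀ f‖, hj₀⟩
    refine ⟨n, hn.2, fun j hj => ?_⟩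
    by_cases hjj : ‖b.coord j₀ f‖ ≤ ‖b.coord j f‖
    · exact hmax j ⟨hjj, hj⟩
    · exact (not_le.1 hjj).le.trans hn.1
  · push Not at h
    obtain ⟨n, hn⟩ := Infinite.exists_notMem_finset F
    exact ⟨n, hn, fun j hj => by simp [h j hj]⟩

/-! ### Greedy orderings -/

/-- An enumeration whose initial segments of length at most `m` are greedy sets extends to a greedy
ordering. -/
theorem exists_isGreedyOrdering (f : X) (m : ℕ) (e : ℕ → ℕ)
    (he : ∀ i ≤ m, b.IsGreedySet f i ((Finset.range i).image e)) :
    ∃ k, b.IsGreedyOrdering f k ∧ ∀ i < m, k i = e i := by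
  classical
  choose pick hpick hmax using b.exists_norm_coord_max f
  -- `F i` is the set of the first `m + i` terms.
  let F : ℕ → Finset ℕ := fun i =>
    Nat.rec ((Finset.range m).image e) (fun _ A => insert (pick A) A) i
  have hF : ∀ i, F (i + 1) = insert (pick (F i)) (F i) := fun i => rfl
  let k : ℕ → ℕ := fun i => if i < m then e i else pick (F (i - m))
  have hkm : ∀ i < m, k i = e i := fun i hi => by simp [k, hi]
  have himg : ∀ i, i ≤ m → (Finset.range i).image k = (Finset.range i).image e := fun i hi =>
    Finset.image_congr fun j hj => hkm j (by simp at hj; omega)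
  have himg' : ∀ i, (Finset.range (m + i)).image k = F i := by
    intro i
    induction i with
    | zero => exact himg m le_rfl
    | succ i ih =>
      rw [← add_assoc, Finset.range_add_one, Finset.image_insert, ih, hF]
      simp [k]
  have hgr : ∀ i, b.IsGreedySet f (m + i) (F i) := by
    intro i
    induction i with
    | zero => exact he m le_rfl
    | succ i ih =>
      refine ⟨by rw [hF, Finset.card_insert_of_notMem (hpick _), ih.1, add_assoc], ?_⟩
      intro n hn j hj
      rw [hF] at hn hj
      have hj' : j ∉ F i := fun h => hj (Finset.mem_insert_of_mem h)
      rcases Finset.mem_insert.1 hn with rfl | hn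
      · exact hmax _ j hj'
      · exact ih.2 n hn j hj'
  refine ⟨k, fun i => ?_, hkm⟩
  rcases le_total i m with hi | hi
  · rw [himg i hi]; exact he i hi
  · obtain ⟨i, rfl⟩ := Nat.exists_eq_add_of_le hi
    rw [himg']; exact hgr i

/-- An enumeration of a greedy set `A` by greedy initial segments extends to one of a larger greedy
set: the last term is taken to be minimal outside `A`. -/
theorem exists_greedy_enumeration (f : X) (m : ℕ) (e : ℕ → ℕ)
    (he : ∀ i ≤ m, b.IsGreedySet f i ((Finset.range i).image e)) (d : ℕ) (A' : Finset ℕ)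
    (hA' : b.IsGreedySet f (m + d) A') (hsub : (Finset.range m).image e ⊆ A') :
    ∃ e' : ℕ → ℕ, (∀ i < m, e' i = e i) ∧ (Finset.range (m + d)).image e' = A' ∧
      ∀ i ≤ m + d, b.IsGreedySet f i ((Finset.range i).image e') := by
  classical
  induction d generalizing A' with
  | zero =>
    exact ⟨e, fun _ _ => rfl, Finset.eq_of_subset_of_card_le hsub
      (hA'.1.trans (he m le_rfl).1.symm).le, he⟩
  | succ d ih =>
    set A := (Finset.range m).image e with hA
    have hcard : (A' \ A).Nonempty := by
      rw [← Finset.card_pos, Finset.card_sdiff_of_subset hsub, hA'.1, (he m le_rfl).1]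
      omega
    obtain ⟨a, ha, hmin⟩ := Finset.exists_min_image (A' \ A) (fun n => ‖b.coord n f‖) hcard
    obtain ⟨haA', haA⟩ := Finset.mem_sdiff.1 ha
    have hc' : (A'.erase a).card = m + d := by
      rw [Finset.card_erase_of_mem haA', hA'.1]; rfl
    obtain ⟨e', h1, h2, h3⟩ := ih (A'.erase a) ⟨hc', by
        intro n hn j hj
        obtain ⟨hna, hnA'⟩ := Finset.mem_erase.1 hn
        by_cases hja : j = a
        · subst hja
          by_cases hnA : n ∈ A
          · exact (he m le_rfl).2 n hnA j haA
          · exact hmin n (Finset.mem_sdiff.2 ⟨hnA', hnA⟩)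
        · exact hA'.2 n hnA' j fun h => hj (Finset.mem_erase.2 ⟨hja, h⟩)⟩
      (fun n hn => Finset.mem_erase.2 ⟨fun h => haA (h ▸ hn), hsub hn⟩)
    have himg : ∀ i ≤ m + d, (Finset.range i).image (Function.update e' (m + d) a)
        = (Finset.range i).image e' := fun i hi => Finset.image_congr fun j hj => by
      have : j ≠ m + d := by simp at hj; omega
      simp [this]
    have hlast : (Finset.range (m + (d + 1))).image (Function.update e' (m + d) a) = A' := by
      rw [← add_assoc, Finset.range_add_one, Finset.image_insert, himg _ le_rfl, h2]
      simp [Finset.insert_erase haA']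
    refine ⟨Function.update e' (m + d) a, fun i hi => ?_, hlast, fun i hi => ?_⟩
    · have : i ≠ m + d := by omega
      simp [this, h1 i hi]
    · rcases Nat.lt_or_ge i (m + (d + 1)) with h | h
      · rw [himg i (by omega)]; exact h3 i (by omega)
      · obtain rfl : i = m + (d + 1) := by omega
        rw [hlast]; exact hA'

/-- A pair of nested greedy sets consists of initial segments of some greedy ordering. -/
theorem exists_isGreedyOrdering_of_subset (f : X) {m m' : ℕ} {A A' : Finset ℕ} (hAA' : A ⊆ A')
    (hA : b.IsGreedySet f m A) (hA' : b.IsGreedySet f m' A') :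
    ∃ k, b.IsGreedyOrdering f k ∧ (Finset.range m).image k = A ∧
      (Finset.range m').image k = A' := by
  have hmm : m ≤ m' := by rw [← hA.1, ← hA'.1]; exact Finset.card_le_card hAA'
  obtain ⟨d, rfl⟩ := Nat.exists_eq_add_of_le hmm
  obtain ⟨e, -, h2, h3⟩ := b.exists_greedy_enumeration f 0 id
    (by intro i hi; obtain rfl : i = 0 := by omega
        exact ⟨by simp, by simp⟩) m A (by simpa using hA) (by simp)
  simp only [zero_add] at h2 h3
  obtain ⟨e', h4, h5, h6⟩ := b.exists_greedy_enumeration f m e h3 d A' hA' (h2 ▸ hAA')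
  obtain ⟨k, hk, hke⟩ := b.exists_isGreedyOrdering f (m + d) e' h6
  refine ⟨k, hk, ?_, ?_⟩
  · rw [← h2]
    exact Finset.image_congr fun j hj => by
      have : j < m := by simpa using hj
      rw [hke j (by omega), h4 j this]
  · rw [← h5]
    exact Finset.image_congr fun j hj => hke j (by simpa using hj)

variable {b}

theorem IsGreedyOrdering.injective {f : X} {k : ℕ → ℕ} (hk : b.IsGreedyOrdering f k) :
    Function.Injective k := by
  have key : ∀ i j, i < j → k i ≠ k j := fun i j hij h => by
    have h1 := (hk (j + 1)).1
    have := Finset.card_image_iff.1 (h1.trans (Finset.card_range _).symm)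
    have := this (by simp; omega : i ∈ (Finset.range (j + 1) : Set ℕ)) (by simp) h
    omega
  intro i j h
  rcases lt_trichotomy i j with hij | hij | hij
  · exact absurd h (key i j hij)
  · exact hij
  · exact absurd h.symm (key j i hij)

theorem IsGreedyOrdering.antitone {f : X} {k : ℕ → ℕ} (hk : b.IsGreedyOrdering f k) :
    Antitone fun j => ‖b.coord (k j) f‖ := by
  refine antitone_nat_of_succ_le fun j => ?_
  refine (hk (j + 1)).2 (k j) (Finset.mem_image_of_mem _ (by simp)) _ fun h => ?_
  obtain ⟨i, hi, hij⟩ := Finset.mem_image.1 h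
  have := hk.injective hij
  simp at hi
  omega

/-! ### Boundedness of the greedy Cesàro sums -/

variable (b)

/-- The unnormalized Cesàro sum `n · Cₙ(f)` for the ordering `k`. The truncated subtraction in the
weights allows the sum to be extended over any longer range. -/
def rampSum (k : ℕ → ℕ) (n : ℕ) (f : X) : X :=
  ∑ j ∈ Finset.range n, (n - j) • (b.coord (k j) f • b.vec (k j))

theorem rampSum_eq_of_le (k : ℕ → ℕ) {n N : ℕ} (h : n ≤ N) (f : X) :
    b.rampSum k n f = ∑ j ∈ Finset.range N, (n - j) • (b.coord (k j) f • b.vec (k j)) := by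
  refine Finset.sum_subset (by simpa using h) fun j _ hj => ?_
  have : n - j = 0 := by simp at hj; omega
  simp [this]

theorem rampSum_eq_smul_cesaroSum (k : ℕ → ℕ) (n : ℕ) (f : X) :
    b.rampSum k n f = (n : 𝕜) • b.cesaroSum k n f := by
  rw [rampSum, cesaroSum, Finset.smul_sum]
  refine Finset.sum_congr rfl fun j hj => ?_
  have hjn : j < n := by simpa using hj
  have hn : (n : 𝕜) ≠ 0 := by exact_mod_cast (by omega : n ≠ 0)
  rw [← Nat.cast_smul_eq_nsmul 𝕜, smul_smul, smul_smul, Nat.cast_sub hjn.le]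
  congr 1
  field_simp

theorem exists_norm_coord_smul_vec_le :
    ∃ β : ℝ, 0 ≤ β ∧ ∀ (f : X) (n : ℕ), ‖b.coord n f‖ * ‖b.vec n‖ ≤ β * ‖f‖ := by
  obtain ⟨M, hM⟩ := b.bounded_vec
  obtain ⟨M', hM'⟩ := b.bounded_coord
  have h0 : 0 ≤ M := (norm_nonneg _).trans (hM 0)
  have h0' : 0 ≤ M' := (norm_nonneg _).trans (hM' 0)
  refine ⟨M' * M, by positivity, fun f n => ?_⟩
  have := (b.coord n).le_of_opNorm_le (hM' n) f
  calc ‖b.coord n f‖ * ‖b.vec n‖ ≤ (M' * ‖f‖) * M := by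
        gcongr
        exact hM n
    _ = M' * M * ‖f‖ := by ring

/-- The greedy Cesàro sums of a de la Vallée-Poussin quasi-greedy basis are bounded. The bound is
carried from `p` to `2 * p` and `2 * p + 1`, since `rampSum k (2 * p) f - rampSum k p f` is `p`
times a de la Vallée-Poussin sum, and consecutive ramp sums differ by a partial sum. -/
theorem exists_norm_rampSum_le {K : ℝ} (hV : b.IsVPQG K) :
    ∃ C : ℝ, 0 < C ∧ ∀ (f : X) (k : ℕ → ℕ), b.IsGreedyOrdering f k → ∀ n : ℕ,
      ‖b.rampSum k n f‖ ≤ C * n * ‖f‖ := by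
  obtain ⟨β, hβ0, hβ⟩ := b.exists_norm_coord_smul_vec_le
  obtain ⟨hK, hV⟩ := hV
  refine ⟨K + 2 * β, by positivity, fun f k hk n => ?_⟩
  induction n using Nat.strong_induction_on with
  | _ n ih =>
    have step : ∀ p, ‖b.rampSum k (2 * p) f - b.rampSum k p f‖ ≤ p * (K * ‖f‖) := fun p => by
      rcases Nat.eq_zero_or_pos p with rfl | hp
      · simp
      · have e : b.rampSum k (2 * p) f - b.rampSum k p f
            = (p : 𝕜) • ((2 : 𝕜) • b.cesaroSum k (2 * p) f - b.cesaroSum k p f) := by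
          rw [rampSum_eq_smul_cesaroSum, rampSum_eq_smul_cesaroSum]
          push_cast
          module
        rw [e, norm_smul, RCLike.norm_natCast]
        exact mul_le_mul_of_nonneg_left (hV f p k hp hk) (Nat.cast_nonneg p)
    have hf := norm_nonneg f
    obtain ⟨p, rfl | rfl⟩ := Nat.even_or_odd' n
    · rcases Nat.eq_zero_or_pos p with rfl | hp
      · simp [rampSum]
      · have h1 := ih p (by omega)
        have h2 := step p
        have h3 := norm_add_le (b.rampSum k (2 * p) f - b.rampSum k p f) (b.rampSum k p f)
        rw [sub_add_cancel] at h3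
        have h4 : 0 ≤ β * (p * ‖f‖) := by positivity
        push_cast
        nlinarith
    · have h1 := ih p (by omega)
      have h2 := step p
      have e : b.rampSum k (2 * p + 1) f = b.rampSum k (2 * p) f
          + ∑ j ∈ Finset.range (2 * p + 1), b.coord (k j) f • b.vec (k j) := by
        rw [b.rampSum_eq_of_le k (Nat.le_succ (2 * p)), rampSum, ← Finset.sum_add_distrib]
        refine Finset.sum_congr rfl fun j hj => ?_
        have : 2 * p + 1 - j = (2 * p - j) + 1 := by simp at hj; omega
        rw [this, add_smul, one_smul]
      have h5 : ‖∑ j ∈ Finset.range (2 * p + 1), b.coord (k j) f • b.vec (k j)‖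
          ≤ (2 * p + 1 : ℕ) * (β * ‖f‖) := by
        refine (norm_sum_le_of_le _ fun j _ => (norm_smul_le _ _).trans (hβ f (k j))).trans ?_
        simp
      have h3 := norm_add_le (b.rampSum k (2 * p) f - b.rampSum k p f) (b.rampSum k p f)
      rw [sub_add_cancel] at h3
      have h6 := norm_add_le (b.rampSum k (2 * p) f)
        (∑ j ∈ Finset.range (2 * p + 1), b.coord (k j) f • b.vec (k j))
      rw [← e] at h6
      have h4 : 0 ≤ K * ‖f‖ := by positivity
      have h7 : 0 ≤ β * ‖f‖ := by positivity
      push_cast at h5 ⊢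
      nlinarith

/-! ### Restriction to a level set of largest coordinates -/

/-- If the Cesàro sums are bounded by `C`, then the projection onto any set of coordinates of
largest modulus costs at most `2 * C`. Such coordinates may be enumerated in any order, and the
ramp weights of an enumeration and of its reversal add up to a constant. -/
theorem norm_proj_le_of_level {C : ℝ}
    (hC : ∀ (f : X) (k : ℕ → ℕ), b.IsGreedyOrdering f k → ∀ n : ℕ,
      ‖b.rampSum k n f‖ ≤ C * n * ‖f‖)
    (hC0 : 0 < C) (f : X) (P : Finset ℕ) (r : ℝ) (hle : ∀ n, ‖b.coord n f‖ ≤ r)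
    (heq : ∀ n ∈ P, ‖b.coord n f‖ = r) : ‖b.proj P f‖ ≤ 2 * C * ‖f‖ := by
  have hgr : ∀ Q ⊆ P, b.IsGreedySet f Q.card Q := fun Q hQ =>
    ⟨rfl, fun n hn j _ => by rw [heq n (hQ hn)]; exact hle j⟩
  set M := P.card with hM
  obtain ⟨k, hk, -, hkP⟩ := b.exists_isGreedyOrdering_of_subset f (Finset.empty_subset P)
    (hgr ∅ (by simp)) (hgr P subset_rfl)
  have hkinj := hk.injective
  obtain ⟨k', hk', hkk'⟩ := b.exists_isGreedyOrdering f M (fun i => k (M - 1 - i)) (by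
    intro i hi
    have hsub : (Finset.range i).image (fun i => k (M - 1 - i)) ⊆ P := by
      intro n hn
      obtain ⟨j, hj, rfl⟩ := Finset.mem_image.1 hn
      rw [← hkP]
      exact Finset.mem_image_of_mem _ (by simp at hj ⊢; omega)
    have hcard : ((Finset.range i).image (fun i => k (M - 1 - i))).card = i := by
      rw [Finset.card_image_of_injOn, Finset.card_range]
      intro a ha c hc hac
      have := hkinj hac
      simp at ha hc
      omega
    have := hgr _ hsub
    rwa [hcard] at this)
  have hsum : b.rampSum k M f + b.rampSum k' M f = (M + 1) • b.proj P f := by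
    have e : b.rampSum k' M f
        = ∑ j ∈ Finset.range M, (j + 1) • (b.coord (k j) f • b.vec (k j)) := by
      rw [← Finset.sum_range_reflect, rampSum]
      refine Finset.sum_congr rfl fun j hj => ?_
      have hj : j < M := by simpa using hj
      rw [hkk' j hj]
      congr 1
      omega
    rw [e, rampSum, ← Finset.sum_add_distrib, proj, ← hkP, Finset.sum_image (hkinj.injOn),
      Finset.smul_sum]
    refine Finset.sum_congr rfl fun j hj => ?_
    have hj : j < M := by simpa using hj
    rw [← add_smul]
    congr 1
    omega
  have h1 := norm_add_le_of_le (hC f k hk M) (hC f k' hk' M)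
  rw [hsum, ← Nat.cast_smul_eq_nsmul 𝕜, norm_smul, RCLike.norm_natCast] at h1
  have hf := norm_nonneg f
  have h2 : 0 ≤ C * ‖f‖ := by positivity
  have hM0 : (0 : ℝ) < (M + 1 : ℕ) := by positivity
  refine le_of_mul_le_mul_left (h1.trans ?_) hM0
  push_cast
  nlinarith

/-! ### Superdemocracy -/

theorem coord_indicatorSum (ε : ℕ → 𝕜) (A : Finset ℕ) (n : ℕ) :
    b.coord n (b.indicatorSum ε A) = if n ∈ A then ε n else 0 :=
  b.coord_sum_smul_vec (k := id) Function.injective_id A ε n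

/-- A basis with bounded Cesàro sums is unconditional for constant coefficients. -/
theorem norm_indicatorSum_mul_le {C : ℝ}
    (hC : ∀ (f : X) (k : ℕ → ℕ), b.IsGreedyOrdering f k → ∀ n : ℕ,
      ‖b.rampSum k n f‖ ≤ C * n * ‖f‖)
    (hC0 : 0 < C) (A : Finset ℕ) (ε c : ℕ → 𝕜) (hε : ∀ n ∈ A, ‖ε n‖ = 1)
    (hc : ∀ n ∈ A, ‖c n‖ ≤ 1) :
    ‖b.indicatorSum (fun n => c n * ε n) A‖ ≤ 2 * (4 * C + 1) * ‖b.indicatorSum ε A‖ := by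
  classical
  set f := b.indicatorSum ε A with hf
  have hsub : ∀ S ⊆ A, ‖∑ n ∈ S, ε n • b.vec n‖ ≤ 2 * C * ‖f‖ := fun S hS => by
    have h := b.norm_proj_le_of_level hC hC0 f S 1 (fun n => by
      rw [hf, coord_indicatorSum]
      split_ifs with h
      · exact (hε n h).le
      · simp) (fun n hn => by rw [hf, coord_indicatorSum, if_pos (hS hn)]; exact hε n (hS hn))
    have e : b.proj S f = ∑ n ∈ S, ε n • b.vec n :=
      Finset.sum_congr rfl fun n hn => by rw [hf, coord_indicatorSum, if_pos (hS hn)]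
    rwa [e] at h
  have hreal : ∀ t : ℕ → ℝ, (∀ n ∈ A, |t n| ≤ 1) →
      ‖∑ n ∈ A, (t n : 𝕜) • (ε n • b.vec n)‖ ≤ (4 * C + 1) * ‖f‖ := fun t ht => by
    have := norm_add_sum_smul_le_of_segment A (fun n => ε n • b.vec n) (fun n => (t n : 𝕜))
      (fun _ => 1) (fun _ => -1) ((4 * C + 1) * ‖f‖) (fun n hn => by
        have := abs_le.1 (ht n hn)
        refine ⟨(1 + t n) / 2, (1 - t n) / 2, by linarith, by linarith, by ring, ?_⟩
        rw [RCLike.real_smul_eq_coe_mul, RCLike.real_smul_eq_coe_mul]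
        push_cast
        ring) 0 fun σ hσ => by
          have e : (0 : X) + ∑ n ∈ A, σ n • (ε n • b.vec n)
              = (2 : 𝕜) • ∑ n ∈ A.filter (fun n => σ n = 1), ε n • b.vec n - f := by
            rw [zero_add, hf, indicatorSum, Finset.sum_filter, Finset.smul_sum,
              ← Finset.sum_sub_distrib]
            refine Finset.sum_congr rfl fun n hn => ?_
            by_cases h1 : σ n = 1
            · rw [if_pos h1, h1]; module
            · rw [if_neg h1, (hσ n hn).resolve_left h1]; module
          rw [e]
          refine (norm_sub_le _ _).trans ?_
          rw [norm_smul, RCLike.norm_ofNat]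
          have := hsub _ (Finset.filter_subset (fun n => σ n = 1) A)
          linarith
    simpa using this
  have hre := hreal (fun n => RCLike.re (c n)) fun n hn => (RCLike.abs_re_le_norm _).trans (hc n hn)
  have him := hreal (fun n => RCLike.im (c n)) fun n hn => (RCLike.abs_im_le_norm _).trans (hc n hn)
  have e : b.indicatorSum (fun n => c n * ε n) A
      = ∑ n ∈ A, ((RCLike.re (c n) : ℝ) : 𝕜) • (ε n • b.vec n)
        + (RCLike.I : 𝕜) • ∑ n ∈ A, ((RCLike.im (c n) : ℝ) : 𝕜) • (ε n • b.vec n) := by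
    rw [indicatorSum, Finset.smul_sum, ← Finset.sum_add_distrib]
    refine Finset.sum_congr rfl fun n _ => ?_
    conv_lhs => rw [← RCLike.re_add_im (c n)]
    module
  rw [e]
  refine (norm_add_le _ _).trans ?_
  have hI : ‖(RCLike.I : 𝕜)‖ ≤ 1 := by
    rcases RCLike.I_eq_zero_or_im_I_eq_one (K := 𝕜) with h | h
    · simp [h]
    · exact (RCLike.norm_I_of_ne_zero (fun h0 => by simp [h0] at h)).le
  rw [norm_smul]
  have := mul_le_mul hI him (norm_nonneg _) zero_le_one
  linarith

theorem exists_isSuperdemocratic {C D : ℝ}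
    (hC : ∀ (f : X) (k : ℕ → ℕ), b.IsGreedyOrdering f k → ∀ n : ℕ,
      ‖b.rampSum k n f‖ ≤ C * n * ‖f‖)
    (hC0 : 0 < C) (hD : b.IsDemocratic D) : ∃ K : ℝ, b.IsSuperdemocratic K := by
  obtain ⟨hD0, hD⟩ := hD
  set C' := 2 * (4 * C + 1) with hC'
  have hC'0 : 0 < C' := by positivity
  refine ⟨C' * (D * C'), by positivity, fun A B ε ε' hAB hε hε' => ?_⟩
  have h1 := b.norm_indicatorSum_mul_le hC hC0 A (fun _ => 1) ε (by simp) fun n hn => (hε n hn).le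
  have h2 := b.norm_indicatorSum_mul_le hC hC0 B ε' (fun n => (ε' n)⁻¹) hε'
    fun n hn => by simp [hε' n hn]
  have e : b.indicatorSum (fun n => (ε' n)⁻¹ * ε' n) B = b.indicatorSum (fun _ => 1) B :=
    Finset.sum_congr rfl fun n hn => by
      have : ε' n ≠ 0 := norm_pos_iff.1 (by rw [hε' n hn]; exact one_pos)
      simp [this]
  rw [e] at h2
  simp only [mul_one] at h1
  calc _ ≤ C' * ‖b.indicatorSum (fun _ => 1) A‖ := h1
    _ ≤ C' * (D * ‖b.indicatorSum (fun _ => 1) B‖) := by gcongr; exact hD A B hAB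
    _ ≤ C' * (D * (C' * ‖b.indicatorSum ε' B‖)) := by gcongr
    _ = _ := by ring

variable {b}

/-- Superdemocracy compares a sum with coefficients of modulus at most `r` over at most
`m * B.card` basis vectors with a unimodular sum over `B`. -/
theorem IsSuperdemocratic.norm_sum_le {K : ℝ} (hK : b.IsSuperdemocratic K) {k : ℕ → ℕ}
    (hk : Function.Injective k) (E B : Finset ℕ) (m : ℕ) (hE : E.card ≤ m * B.card) (c ε : ℕ → 𝕜)
    (r : ℝ) (hr : 0 ≤ r) (hc : ∀ j ∈ E, ‖c j‖ ≤ r) (hε : ∀ n ∈ B, ‖ε n‖ = 1) :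
    ‖∑ j ∈ E, c j • b.vec (k j)‖ ≤ m * (K * (r * ‖b.indicatorSum ε B‖)) := by
  classical
  refine norm_sum_le_of_card_le_mul _ B.card m _ E (fun E' hE' hcard => ?_) hE
  rcases hr.eq_or_lt with rfl | hr
  · have : ∑ j ∈ E', c j • b.vec (k j) = 0 := Finset.sum_eq_zero fun j hj => by
      rw [norm_le_zero_iff.1 (hc j (hE' hj)), zero_smul]
    simp [this]
  -- `E'` is enlarged to a set `G` of the size of `B`, with zero coefficients on the new elements.
  obtain ⟨G, hEG, hG⟩ := Infinite.exists_superset_card_eq E' B.card hcard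
  have hr' : (r : 𝕜) ≠ 0 := by simpa using hr.ne'
  have e : ∑ j ∈ E', c j • b.vec (k j)
      = (r : 𝕜) • ∑ j ∈ G, (if j ∈ E' then c j / (r : 𝕜) else 0) • b.vec (k j) := by
    rw [Finset.smul_sum, ← Finset.sum_subset hEG fun j _ hj => by simp [hj]]
    refine Finset.sum_congr rfl fun j hj => ?_
    rw [if_pos hj, smul_smul]
    congr 1
    field_simp
  rw [e, norm_smul, RCLike.norm_ofReal, abs_of_pos hr]
  have h := norm_sum_smul_le_of_unimodular G (fun j => b.vec (k j))
    (fun j => if j ∈ E' then c j / (r : 𝕜) else 0) (K * ‖b.indicatorSum ε B‖) (fun j _ => by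
      split_ifs with h
      · rw [norm_div, RCLike.norm_ofReal, abs_of_pos hr]
        exact div_le_one_of_le₀ (hc j (hE' h)) hr.le
      · simp) fun δ hδ => by
        have h1 := hK.2 (G.image k) B (δ ∘ Function.invFun k) ε
          (by rw [Finset.card_image_of_injective _ hk, hG])
          (by
            intro n hn
            obtain ⟨j, hj, rfl⟩ := Finset.mem_image.1 hn
            simpa [Function.leftInverse_invFun hk j] using hδ j hj) hε
        rw [indicatorSum, Finset.sum_image hk.injOn] at h1
        simpa [Function.leftInverse_invFun hk _] using h1
  calc _ ≤ r * (K * ‖b.indicatorSum ε B‖) := by gcongr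
    _ = _ := by ring

/-! ### Finiteness of `Ψ(1, 1/4)` -/

variable (b)

/-- The signs of the coordinates of a vector; the value at a vanishing coordinate is `0`. -/
def coordSign (f : X) (n : ℕ) : 𝕜 := b.coord n f / (‖b.coord n f‖ : 𝕜)

theorem norm_coordSign {f : X} {n : ℕ} (h : 0 < ‖b.coord n f‖) : ‖b.coordSign f n‖ = 1 := by
  rw [coordSign, norm_div, RCLike.norm_ofReal, abs_norm, div_self h.ne']

theorem norm_mul_coordSign (f : X) (n : ℕ) :
    (‖b.coord n f‖ : 𝕜) * b.coordSign f n = b.coord n f := by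
  by_cases h : b.coord n f = 0
  · simp [h]
  · have : (‖b.coord n f‖ : 𝕜) ≠ 0 := by simpa using h
    rw [coordSign]
    field_simp

/-- The combination of four ramp sums with corners at `p`, `p + q`, `p + 2q`, `p + 3q` is a
trapezoidal weighting of the terms with index in `[p, p + 3q)`, equal to `q` on the middle third.
If the coordinates in this range are all close to `ν`, it is close to `q ν` times a vector with
exactly known coefficients, whose middle third is controlled by `norm_proj_le_of_level`. The error
is absorbed because `η` is small. -/
theorem norm_indicatorSum_block_le {C K η : ℝ}
    (hC : ∀ (f : X) (k : ℕ → ℕ), b.IsGreedyOrdering f k → ∀ n : ℕ,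
      ‖b.rampSum k n f‖ ≤ C * n * ‖f‖)
    (hC0 : 0 < C) (hK : b.IsSuperdemocratic K) (hη : 0 ≤ η) (hCK : 12 * C * K * η ≤ 1)
    {f : X} {k : ℕ → ℕ} (hk : b.IsGreedyOrdering f k) (p q : ℕ) (hq : 1 ≤ q)
    (hpos : 0 < ‖b.coord (k (p + 3 * q - 1)) f‖)
    (hosc : ‖b.coord (k p) f‖ ≤ (1 + η) * ‖b.coord (k (p + 3 * q - 1)) f‖) :
    q * (‖b.coord (k (p + 3 * q - 1)) f‖ *
        ‖b.indicatorSum (b.coordSign f) ((Finset.Ico (p + q) (p + 2 * q)).image k)‖)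
      ≤ 4 * C * (C * (4 * p + 6 * q) * ‖f‖) := by
  set ν := ‖b.coord (k (p + 3 * q - 1)) f‖ with hν
  set P := (Finset.Ico (p + q) (p + 2 * q)).image k with hP
  set J := Finset.Ico p (p + 3 * q) with hJ
  set Φ := ‖b.indicatorSum (b.coordSign f) P‖ with hΦ
  have hinj := hk.injective
  have hup : ∀ j ∈ J, ‖b.coord (k j) f‖ ≤ (1 + η) * ν := fun j hj =>
    (hk.antitone (Finset.mem_Ico.1 hj).1).trans hosc
  have hlow : ∀ j ∈ J, ν ≤ ‖b.coord (k j) f‖ := fun j hj =>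
    hk.antitone (by have := Finset.mem_Ico.1 hj; omega)
  have hsign : ∀ j ∈ J, ‖b.coordSign f (k j)‖ = 1 := fun j hj =>
    b.norm_coordSign (hpos.trans_le (hlow j hj))
  have hIcoJ : Finset.Ico (p + q) (p + 2 * q) ⊆ J := by
    intro j hj; rw [hJ]; simp only [Finset.mem_Ico] at hj ⊢; omega
  have hPcard : P.card = q := by
    rw [hP, Finset.card_image_of_injective _ hinj, Nat.card_Ico]; omega
  have hPsign : ∀ n ∈ P, ‖b.coordSign f n‖ = 1 := by
    intro n hn
    obtain ⟨j, hj, rfl⟩ := Finset.mem_image.1 hn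
    exact hsign j (hIcoJ hj)
  -- `w` is the trapezoidal weight.
  let w : ℕ → ℕ := fun j =>
    (p + 3 * q - j) + (p - j) - ((p + 2 * q - j) + (p + q - j))
  have hwq : ∀ j, w j ≤ q := fun j => by simp only [w]; omega
  have hwP : ∀ j ∈ Finset.Ico (p + q) (p + 2 * q), w j = q := fun j hj => by
    have := Finset.mem_Ico.1 hj; simp only [w]; omega
  set h : X := ∑ j ∈ J, w j • (b.coord (k j) f • b.vec (k j)) with hh
  have hhS : h = b.rampSum k (p + 3 * q) f + b.rampSum k p f
      - (b.rampSum k (p + 2 * q) f + b.rampSum k (p + q) f) := by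
    rw [eq_sub_iff_add_eq, b.rampSum_eq_of_le k (by omega : p ≤ p + 3 * q),
      b.rampSum_eq_of_le k (by omega : p + 2 * q ≤ p + 3 * q),
      b.rampSum_eq_of_le k (by omega : p + q ≤ p + 3 * q), rampSum, hh,
      Finset.sum_subset (s₂ := Finset.range (p + 3 * q)) (fun j hj => by
        have := Finset.mem_Ico.1 hj; simp; omega) (fun j hj hj' => by
        have : w j = 0 := by
          rw [hJ, Finset.mem_Ico] at hj'; simp at hj; simp only [w]; omega
        simp [this]),
      ← Finset.sum_add_distrib, ← Finset.sum_add_distrib, ← Finset.sum_add_distrib]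
    refine Finset.sum_congr rfl fun j _ => ?_
    rw [← add_smul, ← add_smul, ← add_smul]
    congr 1
    simp only [w]
    omega
  have hhn : ‖h‖ ≤ C * (4 * p + 6 * q) * ‖f‖ := by
    rw [hhS]
    refine (norm_sub_le_of_le (norm_add_le_of_le (hC f k hk _) (hC f k hk _))
      (norm_add_le_of_le (hC f k hk _) (hC f k hk _))).trans (le_of_eq ?_)
    push_cast
    ring
  set u : X := ∑ j ∈ J, ((w j : 𝕜) * ((ν : 𝕜) * b.coordSign f (k j))) • b.vec (k j) with hu
  have hdiff : ‖h - u‖ ≤ (3 : ℕ) * (K * ((q * (η * ν)) * Φ)) := by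
    have e : h - u = ∑ j ∈ J,
        ((w j : 𝕜) * (((‖b.coord (k j) f‖ - ν : ℝ) : 𝕜) * b.coordSign f (k j))) • b.vec (k j) := by
      rw [hh, hu, ← Finset.sum_sub_distrib]
      refine Finset.sum_congr rfl fun j _ => ?_
      rw [← Nat.cast_smul_eq_nsmul 𝕜, smul_smul, ← sub_smul]
      congr 1
      conv_lhs => rw [← b.norm_mul_coordSign f (k j)]
      push_cast
      ring
    rw [e]
    refine hK.norm_sum_le hinj J P 3 (by rw [hJ, hPcard, Nat.card_Ico]; omega) _ _ _
      (by positivity) (fun j hj => ?_) hPsign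
    rw [norm_mul, norm_mul, hsign j hj, mul_one, RCLike.norm_natCast, RCLike.norm_ofReal,
      abs_of_nonneg (sub_nonneg.2 (hlow j hj))]
    have h1 := hup j hj
    have h2 := hlow j hj
    have h3 : (w j : ℝ) ≤ q := by exact_mod_cast hwq j
    exact mul_le_mul h3 (by linarith) (by linarith) (by positivity)
  have hcu : ∀ i ∈ J, b.coord (k i) u = (w i : 𝕜) * ((ν : 𝕜) * b.coordSign f (k i)) :=
    fun i hi => by rw [hu, b.coord_sum_smul_vec hinj, if_pos hi]
  have hcun : ∀ i ∈ J, ‖b.coord (k i) u‖ = w i * ν := fun i hi => by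
    rw [hcu i hi, norm_mul, norm_mul, hsign i hi, RCLike.norm_natCast, RCLike.norm_ofReal,
      abs_of_pos hpos, mul_one]
  have hT := b.norm_proj_le_of_level hC hC0 u P (q * ν) (fun n => by
      by_cases hn : ∃ j ∈ J, k j = n
      · obtain ⟨j, hj, rfl⟩ := hn
        rw [hcun j hj]
        have h3 : (w j : ℝ) ≤ q := by exact_mod_cast hwq j
        gcongr
      · push Not at hn
        rw [hu, b.coord_sum_smul_vec_of_notMem J _ hn, norm_zero]
        positivity) (fun n hn => by
      obtain ⟨j, hj, rfl⟩ := Finset.mem_image.1 hn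
      rw [hcun j (hIcoJ hj), hwP j hj])
  have hproj : ‖b.proj P u‖ = q * (ν * Φ) := by
    have e : b.proj P u = ((q * ν : ℝ) : 𝕜) • b.indicatorSum (b.coordSign f) P := by
      rw [proj, indicatorSum, Finset.smul_sum]
      refine Finset.sum_congr rfl fun n hn => ?_
      obtain ⟨j, hj, rfl⟩ := Finset.mem_image.1 hn
      rw [hcu j (hIcoJ hj), hwP j hj, smul_smul]
      push_cast
      rw [mul_assoc]
    rw [e, norm_smul, RCLike.norm_ofReal, abs_of_nonneg (by positivity), mul_assoc]
  rw [hproj] at hT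
  have hun : ‖u‖ ≤ ‖h‖ + ‖h - u‖ := by
    have := norm_sub_le h (h - u)
    rwa [sub_sub_cancel] at this
  set Y := (q : ℝ) * (ν * Φ) with hY
  have hY0 : 0 ≤ Y := by positivity
  have h5 : 2 * C * (3 * (K * ((q * (η * ν)) * Φ))) ≤ Y / 2 := by
    have : 2 * C * (3 * (K * ((q * (η * ν)) * Φ))) = (12 * C * K * η) * Y / 2 := by
      rw [hY]; ring
    rw [this]
    have := mul_le_mul_of_nonneg_right hCK hY0
    linarith
  push_cast at hdiff
  have h6 : 2 * C * ‖u‖ ≤ 2 * C * (C * (4 * p + 6 * q) * ‖f‖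
      + 3 * (K * ((q * (η * ν)) * Φ))) := by
    gcongr
    linarith
  linarith

/-- If a decreasing sequence loses at most a factor `4` over a range cut into `L` blocks of length
`d`, it loses at most a factor `θ` within one of the blocks, provided that `θ ^ L > 4`. -/
theorem exists_block_of_antitone {a : ℕ → ℝ} (ha : Antitone a) {θ : ℝ} (hθ : 1 < θ) {L d N p : ℕ}
    (hL : 4 < θ ^ L) (hd : 1 ≤ d) (hN : L * d ≤ N) (h4 : a p ≤ 4 * a (p + N - 1))
    (hpos : 0 < a (p + N - 1)) : ∃ i < L, a (p + i * d) ≤ θ * a (p + i * d + d - 1) := by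
  by_contra! hcon
  have hmul : ∀ i, (i + 1) * d = i * d + d := fun i => by ring
  have key : ∀ i, i < L → θ ^ (i + 1) * a (p + (i + 1) * d - 1) ≤ a p := by
    intro i
    induction i with
    | zero =>
      intro h0
      have := (hcon 0 h0).le
      simpa using this
    | succ i ih =>
      intro hi
      have h1 := hcon (i + 1) hi
      have h2 := ih (by omega)
      have h3 : a (p + (i + 1) * d) ≤ a (p + (i + 1) * d - 1) := ha (by omega)
      have h5 : p + (i + 1 + 1) * d - 1 = p + (i + 1) * d + d - 1 := by rw [hmul (i + 1)]; omega
      rw [h5, pow_succ, mul_assoc]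
      refine le_trans ?_ h2
      have : 0 < θ ^ (i + 1) := by positivity
      gcongr
      linarith
  obtain ⟨l, rfl⟩ : ∃ l, L = l + 1 := Nat.exists_eq_succ_of_ne_zero (by
    rintro rfl; norm_num at hL)
  have h1 := key l (by omega)
  have h2 : a (p + N - 1) ≤ a (p + (l + 1) * d - 1) := ha (by omega)
  have h3 : 0 < a (p + (l + 1) * d - 1) := hpos.trans_le h2
  nlinarith

variable {b}

theorem norm_coord_le_of_osc_le {y : X} {B : Finset ℕ} {R : ℝ} (hB : ∀ n ∈ B, b.coord n y ≠ 0)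
    (hosc : b.osc y B ≤ R) {n n' : ℕ} (hn : n ∈ B) (hn' : n' ∈ B) :
    ‖b.coord n y‖ ≤ R * ‖b.coord n' y‖ := by
  have hne : B.Nonempty := ⟨n, hn⟩
  rw [osc, dif_pos hne, div_le_iff₀ ((Finset.lt_inf'_iff _).2
    fun i hi => norm_pos_iff.2 (hB i hi))] at hosc
  have h0 : 0 < B.inf' hne (fun n => ‖b.coord n y‖) :=
    (Finset.lt_inf'_iff _).2 fun i hi => norm_pos_iff.2 (hB i hi)
  have h1 := Finset.le_sup' (fun n => ‖b.coord n y‖) hn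
  have h2 := Finset.inf'_le (fun n => ‖b.coord n y‖) hn'
  have hR : 0 ≤ R := by
    by_contra! hR
    have := norm_nonneg (b.coord n y)
    nlinarith
  calc _ ≤ _ := h1
    _ ≤ _ := hosc
    _ ≤ _ := by gcongr

theorem coord_eq_zero_of_disjoint {x y : X} (h : Disjoint (b.supp x) (b.supp y)) {n : ℕ}
    (hn : n ∈ b.supp x) : b.coord n y = 0 := by
  by_contra h0
  exact Set.disjoint_left.1 h hn h0

/-- Bounded Cesàro sums and superdemocracy make `Ψ(1, 1/4)` finite. Among the positions of the
support of `y` in a greedy ordering of `x + y + z` there is a block of proportional length on which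
the coordinates are nearly constant, and superdemocracy compares the rest of `y` with it. -/
theorem Psi_ne_top {C K : ℝ}
    (hC : ∀ (f : X) (k : ℕ → ℕ), b.IsGreedyOrdering f k → ∀ n : ℕ,
      ‖b.rampSum k n f‖ ≤ C * n * ‖f‖)
    (hC0 : 0 < C) (hK : b.IsSuperdemocratic K) : b.Psi 1 (1 / 4) ≠ ⊤ := by
  obtain ⟨β, hβ0, hβ⟩ := b.exists_norm_coord_smul_vec_le
  have hK0 := hK.1
  set η := 1 / (12 * C * K) with hη
  have hη0 : 0 < η := by positivity
  have hCK : 12 * C * K * η ≤ 1 := by rw [hη, mul_one_div, div_self (by positivity)]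
  obtain ⟨L, hL⟩ := pow_unbounded_of_one_lt 4 (by linarith : 1 < 1 + η)
  have hL0 : 0 < L := Nat.pos_of_ne_zero (by rintro rfl; norm_num at hL)
  set Q := 24 * L * K * (4 * C * (C * (48 * L + 6))) with hQ
  have hQ0 : 0 ≤ Q := by positivity
  set R : ℝ := 1 + 3 * L * β + Q with hR
  have hRβ : 0 ≤ 3 * L * β := by positivity
  suffices hbound : b.PsiBound 1 (1 / 4) (ENNReal.ofReal R) by
    have : b.Psi 1 (1 / 4) ≤ ENNReal.ofReal R :=
      sInf_le ⟨ENNReal.one_le_ofReal.2 (by linarith), hbound⟩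
    exact (this.trans_lt ENNReal.ofReal_lt_top).ne
  intro x y z B a hxy hxz hyz hdxy hdyz hB hfin hcard hosc ha
  rw [← ENNReal.ofReal_mul (by linarith)]
  refine ENNReal.ofReal_le_ofReal ?_
  set f := x + y + z with hf
  have hf0 := norm_nonneg f
  rcases B.eq_empty_or_nonempty with rfl | hBne
  · simp only [Finset.sum_empty, norm_zero]; positivity
  have hmemB : ∀ {n}, n ∈ B ↔ n ∈ b.supp y := fun {n} => by rw [← hB]; simp
  have hyB : ∀ n ∈ B, b.coord n y ≠ 0 := fun n hn => hmemB.1 hn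
  -- The coordinates of `f` are those of `x`, `y`, `z` on the respective supports.
  have hfx : ∀ n ∈ b.supp x, b.coord n f = b.coord n x := fun n hn => by
    simp [hf, coord_eq_zero_of_disjoint hxy hn, coord_eq_zero_of_disjoint hxz hn]
  have hfy : ∀ n ∈ b.supp y, b.coord n f = b.coord n y := fun n hn => by
    simp [hf, coord_eq_zero_of_disjoint hxy.symm hn, coord_eq_zero_of_disjoint hyz hn]
  have hfz : ∀ n, n ∉ b.supp x → n ∉ b.supp y → b.coord n f = b.coord n z := fun n h1 h2 => by
    have h1 : b.coord n x = 0 := not_not.1 h1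
    have h2 : b.coord n y = 0 := not_not.1 h2
    simp [hf, h1, h2]
  set N := B.card with hN
  have hN1 : 1 ≤ N := hBne.card_pos
  have hf4 : ∀ n ∈ B, ∀ n' ∈ B, ‖b.coord n f‖ ≤ 4 * ‖b.coord n' f‖ := fun n hn n' hn' => by
    rw [hfy n (hmemB.1 hn), hfy n' (hmemB.1 hn')]
    have := norm_coord_le_of_osc_le hyB hosc hn hn'
    norm_num at this
    exact this
  have hcoef : ∀ n ∈ B, ‖a n * b.coord n y‖ ≤ ‖b.coord n f‖ := fun n hn => by
    rw [hfy n (hmemB.1 hn), norm_mul]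
    exact mul_le_of_le_one_left (norm_nonneg _) (ha n hn)
  rcases lt_or_ge N (3 * L) with hNL | hNL
  · have h1 : ‖∑ j ∈ B, (a j * b.coord j y) • b.vec j‖ ≤ N * (β * ‖f‖) := by
      refine (norm_sum_le_of_le B fun j hj => ?_).trans
        (le_of_eq (by rw [Finset.sum_const, nsmul_eq_mul]))
      refine (norm_smul_le _ _).trans (le_trans ?_ (hβ f j))
      exact mul_le_mul_of_nonneg_right (hcoef j hj) (norm_nonneg _)
    have h2 : (N : ℝ) ≤ 3 * L := by exact_mod_cast hNL.le
    have h3 : (N : ℝ) * (β * ‖f‖) ≤ 3 * L * (β * ‖f‖) := by gcongr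
    have h4 : 0 ≤ (1 + Q) * ‖f‖ := by positivity
    rw [hR]
    linarith
  set A := hfin.toFinset with hA
  have hmemA : ∀ {n}, n ∈ A ↔ n ∈ b.supp x := fun {n} => by simp [hA]
  set p₀ := A.card with hp₀
  have hp₀N : p₀ ≤ N := by
    rw [Set.ncard_eq_toFinset_card _ hfin, one_mul] at hcard
    exact_mod_cast hcard
  have hAB : Disjoint A B := Finset.disjoint_left.2 fun n h1 h2 =>
    Set.disjoint_left.1 hxy (hmemA.1 h1) (hmemB.1 h2)
  obtain ⟨n₀, hn₀⟩ := hBne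
  have hgA : b.IsGreedySet f p₀ A := by
    refine ⟨rfl, fun n hn j hj => ?_⟩
    rw [hfx n (hmemA.1 hn)]
    by_cases hjB : j ∈ b.supp y
    · rw [hfy j hjB]; exact hdxy n (hmemA.1 hn) j
    · rw [hfz j (fun h => hj (hmemA.2 h)) hjB]
      exact (hdyz n₀ (hmemB.1 hn₀) j).trans (hdxy n (hmemA.1 hn) n₀)
  have hgAB : b.IsGreedySet f (p₀ + N) (A ∪ B) := by
    refine ⟨Finset.card_union_of_disjoint hAB, fun n hn j hj => ?_⟩
    rw [Finset.mem_union, not_or] at hj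
    rcases Finset.mem_union.1 hn with hn | hn
    · exact hgA.2 n hn j hj.1
    · rw [hfy n (hmemB.1 hn), hfz j (fun h => hj.1 (hmemA.2 h)) (fun h => hj.2 (hmemB.2 h))]
      exact hdyz n (hmemB.1 hn) j
  obtain ⟨k, hk, hkA, hkAB⟩ :=
    b.exists_isGreedyOrdering_of_subset f Finset.subset_union_left hgA hgAB
  have hkB : ∀ j, p₀ ≤ j → j < p₀ + N → k j ∈ B := fun j h1 h2 => by
    have : k j ∈ A ∪ B := hkAB ▸ Finset.mem_image_of_mem k (by simpa using h2)
    refine (Finset.mem_union.1 this).resolve_left fun h => ?_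
    rw [← hkA] at h
    obtain ⟨i, hi, hij⟩ := Finset.mem_image.1 h
    have := hk.injective hij
    simp at hi
    omega
  have hpos : ∀ n ∈ B, 0 < ‖b.coord n f‖ := fun n hn => by
    rw [hfy n (hmemB.1 hn)]; exact norm_pos_iff.2 (hyB n hn)
  set q := N / (3 * L) with hq
  have hq1 : 1 ≤ q := (Nat.one_le_div_iff (by omega)).2 hNL
  have hqN : L * (3 * q) ≤ N := by
    have := Nat.mul_div_le N (3 * L)
    calc L * (3 * q) = 3 * L * q := by ring
      _ ≤ N := this
  have hNq : N ≤ 6 * L * q := by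
    have h1 : N < 3 * L * (q + 1) := Nat.lt_mul_div_succ N (by omega)
    have h2 : 3 * L * (q + 1) ≤ 3 * L * (q + q) := by gcongr
    have h3 : 3 * L * (q + q) = 6 * L * q := by ring
    omega
  obtain ⟨i, hi, hblock⟩ := exists_block_of_antitone hk.antitone (by linarith : 1 < 1 + η) hL
    (by omega : 1 ≤ 3 * q) hqN (hf4 _ (hkB p₀ le_rfl (by omega)) _ (hkB _ (by omega) (by omega)))
    (hpos _ (hkB (p₀ + N - 1) (by omega) (by omega)))
  have hiq : i * (3 * q) + 3 * q ≤ N := by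
    calc i * (3 * q) + 3 * q = (i + 1) * (3 * q) := by ring
      _ ≤ L * (3 * q) := by gcongr; omega
      _ ≤ N := hqN
  set p := p₀ + i * (3 * q) with hp
  have hend : k (p + 3 * q - 1) ∈ B := hkB _ (by omega) (by omega)
  have hmain := b.norm_indicatorSum_block_le hC hC0 hK hη0.le hCK hk p q hq1 (hpos _ hend) hblock
  set ν := ‖b.coord (k (p + 3 * q - 1)) f‖ with hν
  set P := (Finset.Ico (p + q) (p + 2 * q)).image k with hP
  set Φ := ‖b.indicatorSum (b.coordSign f) P‖ with hΦ
  have hPcard : P.card = q := by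
    rw [hP, Finset.card_image_of_injective _ hk.injective, Nat.card_Ico]; omega
  have hfinal := hK.norm_sum_le Function.injective_id B P (6 * L) (by rw [hPcard]; exact hNq)
    (fun j => a j * b.coord j y) (b.coordSign f) (4 * ν) (by positivity)
    (fun j hj => (hcoef j hj).trans (hf4 j hj _ hend)) (fun n hn => by
      obtain ⟨j, hj, rfl⟩ := Finset.mem_image.1 hn
      have := Finset.mem_Ico.1 hj
      exact b.norm_coordSign (hpos _ (hkB j (by omega) (by omega))))
  have hνΦ : ν * Φ ≤ 4 * C * (C * (48 * L + 6)) * ‖f‖ := by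
    have hq0 : (0 : ℝ) < q := by exact_mod_cast hq1
    refine le_of_mul_le_mul_left (hmain.trans ?_) hq0
    have hpq : p ≤ 12 * L * q := by
      have : 12 * L * q = 2 * (6 * L * q) := by ring
      omega
    have hpq' : (p : ℝ) ≤ 12 * L * q := by exact_mod_cast hpq
    calc 4 * C * (C * (4 * p + 6 * q) * ‖f‖)
        ≤ 4 * C * (C * (4 * (12 * L * q) + 6 * q) * ‖f‖) := by gcongr
      _ = q * (4 * C * (C * (48 * L + 6)) * ‖f‖) := by ring
  refine hfinal.trans ?_
  push_cast
  calc (6 * L : ℝ) * (K * (4 * ν * Φ)) = 24 * L * K * (ν * Φ) := by ring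
    _ ≤ 24 * L * K * (4 * C * (C * (48 * L + 6)) * ‖f‖) := by gcongr
    _ = Q * ‖f‖ := by rw [hQ]; ring
    _ ≤ R * ‖f‖ := by gcongr; linarith

/-! ### Quasi-greediness -/

/-- The infimum defining `Ψ` is attained. -/
theorem psiBound_Psi {t s : ℝ} (h : b.Psi t s ≠ ⊤) : b.PsiBound t s (b.Psi t s) := by
  intro x y z B a h1 h2 h3 h4 h5 h6 h7 h8 h9 h10
  by_cases h0 : ENNReal.ofReal ‖x + y + z‖ = 0
  · obtain ⟨C, hC, -⟩ := sInf_lt_iff.1 (lt_top_iff_ne_top.2 h)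
    have := hC.2 x y z B a h1 h2 h3 h4 h5 h6 h7 h8 h9 h10
    rw [h0, mul_zero] at this ⊢
    exact this
  · rw [← ENNReal.div_le_iff h0 ENNReal.ofReal_ne_top]
    refine le_sInf fun C hC => ?_
    rw [ENNReal.div_le_iff h0 ENNReal.ofReal_ne_top]
    exact hC.2 x y z B a h1 h2 h3 h4 h5 h6 h7 h8 h9 h10

/-- `Ψ(1, 1/4)` controls the signs on a block of a greedy ordering that is at least as long as its
distance from the beginning and on which the coordinates vary by at most a factor `4`. -/
theorem norm_indicatorSum_Ico_le_Psi (hΨ : b.Psi 1 (1 / 4) ≠ ⊤) {f : X} {k : ℕ → ℕ}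
    (hk : b.IsGreedyOrdering f k) {p m : ℕ} (hpm : p < m) (hp : p ≤ m - p)
    (hpos : 0 < ‖b.coord (k (m - 1)) f‖)
    (h4 : ‖b.coord (k p) f‖ ≤ 4 * ‖b.coord (k (m - 1)) f‖) :
    ‖b.coord (k (m - 1)) f‖ * ‖b.indicatorSum (b.coordSign f) ((Finset.Ico p m).image k)‖
      ≤ (b.Psi 1 (1 / 4)).toReal * ‖f‖ := by
  set ν := ‖b.coord (k (m - 1)) f‖ with hν
  have hinj := hk.injective
  set A := (Finset.range p).image k with hA
  set P := (Finset.Ico p m).image k with hP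
  have hAP : A ∪ P = (Finset.range m).image k := by
    rw [hA, hP, ← Finset.image_union]
    congr 1
    ext j; simp; omega
  have hdisj : ∀ n ∈ A, n ∉ P := fun n h1 h2 => by
    obtain ⟨i, hi, rfl⟩ := Finset.mem_image.1 h1
    obtain ⟨j, hj, hij⟩ := Finset.mem_image.1 h2
    have := hinj hij
    simp at hi hj
    omega
  have hlow : ∀ n ∈ A ∪ P, ν ≤ ‖b.coord n f‖ := fun n hn => by
    rw [hAP] at hn
    obtain ⟨j, hj, rfl⟩ := Finset.mem_image.1 hn
    exact hk.antitone (by simp at hj; omega)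
  have hPlow : ∀ n ∈ P, ν ≤ ‖b.coord n f‖ := fun n hn => hlow n (Finset.mem_union_right _ hn)
  have hPup : ∀ n ∈ P, ‖b.coord n f‖ ≤ 4 * ν := fun n hn => by
    obtain ⟨j, hj, rfl⟩ := Finset.mem_image.1 hn
    exact (hk.antitone (Finset.mem_Ico.1 hj).1).trans h4
  set x := b.proj A f with hx
  set y := b.proj P f with hy
  set z := f - x - y with hz
  have hcz : ∀ n, b.coord n z = if n ∈ A ∪ P then 0 else b.coord n f := fun n => by
    simp only [hz, map_sub, hx, hy, coord_proj, Finset.mem_union]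
    by_cases h1 : n ∈ A
    · simp [h1, hdisj n h1]
    · by_cases h2 : n ∈ P <;> simp [h1, h2]
  have hsx : ∀ n, n ∈ b.supp x → n ∈ A := fun n hn => by
    by_contra h; exact hn (by rw [hx, coord_proj, if_neg h])
  have hsy : ∀ n, n ∈ b.supp y ↔ n ∈ P := fun n => by
    constructor
    · intro hn
      by_contra h; exact hn (by rw [hy, coord_proj, if_neg h])
    · intro hn
      have : b.coord n y = b.coord n f := by rw [hy, coord_proj, if_pos hn]
      change b.coord n y ≠ 0
      rw [this]
      exact norm_pos_iff.1 (hpos.trans_le (hPlow n hn))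
  have hsz : ∀ n, n ∈ b.supp z → n ∉ A ∪ P := fun n hn h => hn (by rw [hcz, if_pos h])
  have hcy : ∀ n ∈ P, b.coord n y = b.coord n f := fun n hn => by rw [hy, coord_proj, if_pos hn]
  have hPne : P.Nonempty := (Finset.nonempty_Ico.2 hpm).image k
  have hsxA : b.supp x ⊆ (A : Set ℕ) := fun n hn => hsx n hn
  have key := psiBound_Psi hΨ x y z P (fun n => (ν / ‖b.coord n f‖ : ℝ))
    (Set.disjoint_left.2 fun n h1 h2 => hdisj n (hsx n h1) ((hsy n).1 h2))
    (Set.disjoint_left.2 fun n h1 h2 => hsz n h2 (Finset.mem_union_left _ (hsx n h1)))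
    (Set.disjoint_left.2 fun n h1 h2 => hsz n h2 (Finset.mem_union_right _ ((hsy n).1 h1)))
    (fun n hn j => by
      have hnA := hsx n hn
      rw [hx, hy, coord_proj, coord_proj, if_pos hnA]
      split_ifs with hj
      · exact (hk p).2 n hnA j fun h => hdisj j h hj
      · simp)
    (fun n hn j => by
      have hnP := (hsy n).1 hn
      rw [hcz, hcy n hnP]
      split_ifs with hj
      · simp
      · rw [hAP] at hj
        exact (hk m).2 n (hAP ▸ Finset.mem_union_right _ hnP) j hj)
    (by ext n; simp [hsy])
    (A.finite_toSet.subset hsxA)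
    (by
      have h1 := Set.ncard_le_ncard hsxA A.finite_toSet
      rw [Set.ncard_coe_finset, (hk p).1] at h1
      have h2 : P.card = m - p := by rw [hP, Finset.card_image_of_injective _ hinj, Nat.card_Ico]
      rw [one_mul, h2]
      exact_mod_cast h1.trans hp)
    (by
      rw [osc, dif_pos hPne]
      have hinf : ν ≤ P.inf' hPne (fun n => ‖b.coord n y‖) :=
        Finset.le_inf' _ _ fun n hn => by rw [hcy n hn]; exact hPlow n hn
      have hsup : P.sup' hPne (fun n => ‖b.coord n y‖) ≤ 4 * ν :=
        Finset.sup'_le _ _ fun n hn => by rw [hcy n hn]; exact hPup n hn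
      rw [div_le_iff₀ (hpos.trans_le hinf)]
      rw [show ((1 : ℝ) / 4)⁻¹ = 4 by norm_num]
      linarith)
    (fun n hn => by
      rw [RCLike.norm_ofReal, abs_of_nonneg (by positivity)]
      exact div_le_one_of_le₀ (hPlow n hn) (norm_nonneg _))
  have hxyz : x + y + z = f := by rw [hz]; abel
  have hsum : ∑ n ∈ P, (((ν / ‖b.coord n f‖ : ℝ) : 𝕜) * b.coord n y) • b.vec n
      = (ν : 𝕜) • b.indicatorSum (b.coordSign f) P := by
    rw [indicatorSum, Finset.smul_sum]
    refine Finset.sum_congr rfl fun n hn => ?_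
    rw [hcy n hn, smul_smul, coordSign]
    congr 1
    push_cast
    ring
  rw [hxyz, hsum, norm_smul, RCLike.norm_ofReal, abs_of_pos hpos, ← ENNReal.ofReal_toReal hΨ,
    ← ENNReal.ofReal_mul ENNReal.toReal_nonneg,
    ENNReal.ofReal_le_ofReal_iff (by positivity)] at key
  exact key

/-- Sums of at most `m` terms with coefficients at most the `m`-th largest coordinate of `f` are
bounded by `‖f‖`. If the coordinates vary by at most a factor `4` over the second half of the
first `m` positions, that half provides the bound; otherwise the passage from `m` to `m / 2` gains a
factor `4` in the coefficients and loses only a factor `3` in the number of terms. -/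
theorem IsSuperdemocratic.norm_sum_le_Psi {K : ℝ} (hK : b.IsSuperdemocratic K)
    (hΨ : b.Psi 1 (1 / 4) ≠ ⊤) {f : X} {k : ℕ → ℕ} (hk : b.IsGreedyOrdering f k) {m : ℕ}
    (hm : 1 ≤ m) (E : Finset ℕ) (hE : E.card ≤ m) (c : ℕ → 𝕜)
    (hc : ∀ j ∈ E, ‖c j‖ ≤ ‖b.coord (k (m - 1)) f‖) :
    ‖∑ j ∈ E, c j • b.vec (k j)‖ ≤ 2 * K * (b.Psi 1 (1 / 4)).toReal * ‖f‖ := by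
  classical
  have hK0 := hK.1
  set Ψ := (b.Psi 1 (1 / 4)).toReal with hΨr
  have hΨ0 : 0 ≤ Ψ := ENNReal.toReal_nonneg
  induction m using Nat.strong_induction_on generalizing E c with
  | _ m ih =>
    rcases (norm_nonneg (b.coord (k (m - 1)) f)).eq_or_lt with h0 | hpos
    · rw [Finset.sum_eq_zero fun j hj => by
        rw [norm_le_zero_iff.1 ((hc j hj).trans h0.ge), zero_smul], norm_zero]
      positivity
    rcases le_or_gt ‖b.coord (k (m / 2)) f‖ (4 * ‖b.coord (k (m - 1)) f‖) with h4 | h4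
    · have h1 := norm_indicatorSum_Ico_le_Psi hΨ hk (by omega : m / 2 < m) (by omega) hpos h4
      have h2 := hK.norm_sum_le hk.injective E ((Finset.Ico (m / 2) m).image k) 2
        (by rw [Finset.card_image_of_injective _ hk.injective, Nat.card_Ico]; omega)
        c (b.coordSign f) _ hpos.le hc (fun n hn => by
          obtain ⟨j, hj, rfl⟩ := Finset.mem_image.1 hn
          have := Finset.mem_Ico.1 hj
          exact b.norm_coordSign (hpos.trans_le (hk.antitone (by omega))))
      refine h2.trans ?_
      push_cast
      calc _ ≤ 2 * (K * (Ψ * ‖f‖)) := by gcongr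
        _ = _ := by ring
    · have hm2 : 1 ≤ m / 2 := by
        by_contra hlt
        have h1 : m / 2 = 0 := by omega
        have h2 : m - 1 = 0 := by omega
        rw [h1, h2] at h4
        rw [h2] at hpos
        linarith
      have h3 := norm_sum_le_of_card_le_mul (fun j => c j • b.vec (k j)) (m / 2) 3
        (1 / 4 * (2 * K * Ψ * ‖f‖)) E (fun E' hE' hcard => by
          have h5 := ih (m / 2) (by omega) hm2 E' hcard (fun j => 4 * c j) (fun j hj => by
            rw [norm_mul, RCLike.norm_ofNat]
            have h6 := hc j (hE' hj)
            have h7 : ‖b.coord (k (m / 2)) f‖ ≤ ‖b.coord (k (m / 2 - 1)) f‖ :=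
              hk.antitone (by omega)
            linarith)
          simp only [mul_smul] at h5
          rw [← Finset.smul_sum, norm_smul, RCLike.norm_ofNat] at h5
          linarith) (by omega)
      have : 0 ≤ 2 * K * Ψ * ‖f‖ := by positivity
      push_cast at h3
      linarith

/-- The de la Vallée-Poussin sum is the partial sum plus a block with weights at most `1`. -/
theorem two_smul_cesaroSum_sub_cesaroSum (f : X) (k : ℕ → ℕ) {m : ℕ} (hm : 1 ≤ m) :
    (2 : 𝕜) • b.cesaroSum k (2 * m) f - b.cesaroSum k m f
      = ∑ j ∈ Finset.range m, b.coord (k j) f • b.vec (k j)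
        + ∑ j ∈ Finset.Ico m (2 * m),
            (((2 * m - j : ℕ) : 𝕜) / (m : 𝕜) * b.coord (k j) f) • b.vec (k j) := by
  have hm0 : (m : 𝕜) ≠ 0 := by exact_mod_cast (by omega : m ≠ 0)
  simp only [cesaroSum]
  rw [← Finset.sum_range_add_sum_Ico _ (by omega : m ≤ 2 * m), smul_add, Finset.smul_sum,
    Finset.smul_sum, add_sub_right_comm, ← Finset.sum_sub_distrib]
  congr 1
  · refine Finset.sum_congr rfl fun j _ => ?_
    rw [smul_smul, ← sub_smul]
    congr 1
    push_cast
    field_simp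
    ring
  · refine Finset.sum_congr rfl fun j hj => ?_
    rw [smul_smul, Nat.cast_sub (Finset.mem_Ico.1 hj).2.le]
    congr 1
    push_cast
    field_simp

theorem IsVPQG.isQuasiGreedy {K₁ K₂ : ℝ} (hV : b.IsVPQG K₁) (hK : b.IsSuperdemocratic K₂)
    (hΨ : b.Psi 1 (1 / 4) ≠ ⊤) :
    b.IsQuasiGreedy (K₁ + (2 + 4 * K₂) * (b.Psi 1 (1 / 4)).toReal) := by
  have hΨ0 : 0 ≤ (b.Psi 1 (1 / 4)).toReal := ENNReal.toReal_nonneg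
  have hK0 := hK.1
  have hV0 := hV.1
  refine ⟨by positivity, fun f m A hA => ?_⟩
  rcases Nat.eq_zero_or_pos m with rfl | hm
  · rw [Finset.card_eq_zero.1 hA.1, proj, Finset.sum_empty, norm_zero]
    positivity
  obtain ⟨k, hk, -, hkA⟩ := b.exists_isGreedyOrdering_of_subset f (Finset.empty_subset A)
    (⟨rfl, by simp⟩ : b.IsGreedySet f 0 ∅) hA
  have h1 := hV.2 f m k hm hk
  have e : b.proj A f = ∑ j ∈ Finset.range m, b.coord (k j) f • b.vec (k j) := by
    rw [proj, ← hkA, Finset.sum_image hk.injective.injOn]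
  have hm0 : (0 : ℝ) < m := by exact_mod_cast hm
  have h2 := hK.norm_sum_le_Psi hΨ hk hm (Finset.Ico m (2 * m)) (by rw [Nat.card_Ico]; omega)
    (fun j => ((2 * m - j : ℕ) : 𝕜) / (m : 𝕜) * b.coord (k j) f) (fun j hj => by
      have hj := Finset.mem_Ico.1 hj
      rw [norm_mul, norm_div, RCLike.norm_natCast, RCLike.norm_natCast]
      have h3 : ((2 * m - j : ℕ) : ℝ) / m ≤ 1 :=
        div_le_one_of_le₀ (by exact_mod_cast (by omega : 2 * m - j ≤ m)) hm0.le
      exact (mul_le_of_le_one_left (norm_nonneg _) h3).trans (hk.antitone (by omega)))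
  rw [two_smul_cesaroSum_sub_cesaroSum f k hm, ← e] at h1
  have h3 := norm_le_add_norm_add (b.proj A f) (∑ j ∈ Finset.Ico m (2 * m),
    (((2 * m - j : ℕ) : 𝕜) / (m : 𝕜) * b.coord (k j) f) • b.vec (k j))
  have h4 : 0 ≤ (2 + 2 * K₂) * (b.Psi 1 (1 / 4)).toReal * ‖f‖ := by positivity
  linarith

end GreedyBasis

theorem mainTheorem5 {𝕜 : Type*} {X : Type*} [RCLike 𝕜] [NormedAddCommGroup X]
    [NormedSpace 𝕜 X] [CompleteSpace X] (b : GreedyBasis 𝕜 X)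
    (hV : ∃ K : ℝ, b.IsVPQG K) (hD : ∃ D : ℝ, b.IsDemocratic D) :
    (∃ C : ℝ, b.IsQuasiGreedy C) ∧
    (∃ K₂ : ℝ, b.IsSuperdemocratic K₂) ∧
    b.Psi 1 (1 / 4) ≠ ⊤ ∧
    ∀ K₁ K₂ : ℝ, b.IsVPQG K₁ → b.IsSuperdemocratic K₂ →
      b.IsQuasiGreedy (K₁ + (2 + 4 * K₂) * (b.Psi 1 (1 / 4)).toReal) := by
  obtain ⟨K, hV⟩ := hV
  obtain ⟨D, hD⟩ := hD
  obtain ⟨C, hC0, hC⟩ := b.exists_norm_rampSum_le hV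
  obtain ⟨K₂, hK⟩ := b.exists_isSuperdemocratic hC hC0 hD
  have hΨ := GreedyBasis.Psi_ne_top hC hC0 hK
  exact ⟨⟨_, hV.isQuasiGreedy hK hΨ⟩, ⟨K₂, hK⟩, hΨ, fun _ _ h₁ h₂ => h₁.isQuasiGreedy h₂ hΨ⟩
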